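/- **Setting.** Let $q,d$ be numbers of agents and objects, $\alpha>0$ and $K_1,\dots,K_d>0$. Let $V=(V_1,\dots,V_d)^\top$ be a random vector of nonnegative claims with Pareto tails, $P(V_j>t)\sim K_jt^{-\alpha}$ as $t\to\infty$ for every $j$. Let $A=(A_{ij})$ be a random $q\times d$ matrix with $A_{ij}=\mathbf 1(i\sim j)\,W_{ij}$, where $\{i\sim j\}$ is the (random) event that agent $i$ and object $j$ are linked in a random bipartite graph and $W_{ij}\ge 0$ is a possibly random weight. Assume that $A$ is independent of $V$ and that $\mathbb E A_{ij}^\alpha<\infty$ for all $i,j$. Let $F=AV$ be the vector of exposures, let $\|\cdot\|$ be a norm on $\mathbb R^q$ under which all canonical unit vectors have norm $1$, let $e_j$ be the canonical unit vectors of $\mathbb R^d$, and let $K^{1/\alpha}1=(K_1^{1/\alpha},\dots,K_d^{1/\alpha})^\top$. An exponent measure of $V$ is a nonzero Radon measure $\nu$ on $[0,\infty]^d\setminus\{0\}$ such that $n\,P(n^{-1/\alpha}V\in\cdot)\to\nu$ vaguely as $n\to\infty$ (that is, the integrals of all continuous functions with compact support in $[0,\infty]^d\setminus\{0\}$ converge).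 The claims are *asymptotically independent* if $V$ has an exponent measure that has mass only on the coordinate axes, and *asymptotically fully dependent* if $V$ has an exponent measure that has mass only on $\{sK^{1/\alpha}1: s>0\}$. For $C\ge 0$ we write $f(t)\sim Ct^{-\alpha}$ for $\lim_{t\to\infty}t^\alpha f(t)=C$; for $C>0$ this means $f(t)/(Ct^{-\alpha})\to1$, and for $C=0$ it means $f(t)=o(t^{-\alpha})$. **Theorem.** As $t\to\infty$: 1. For every agent $i$, $P(F_i>t)\sim Ct^{-\alpha}$, with $C=C^i_{ind}=\sum_{j=1}^dK_j\,\mathbb E A_{ij}^\alpha$ if $V_1,\dots,V_d$ are asymptotically independent, and $C=C^i_{dep}=\mathbb E\big[(AK^{1/\alpha}1)_i^\alpha\big]$ if they are asymptotically fully dependent. 2. For every nonempty subset $\{i_1,\dots,i_k\}$ of $\{1,\dots,q\}$ and all $u_1,\dots,u_k>0$, $$P(F_{i_1}>u_1t,\dots,F_{i_k}>u_kt)\sim\sum_{j=1}^dK_j\,\mathbb E\Big[\min\Big\{\frac{A_{i_1j}}{u_1},\dots,\frac{A_{i_kj}}{u_k}\Big\}^\alpha\Big]\,t^{-\alpha}$$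 if $V_1,\dots,V_d$ are asymptotically independent, and $$P(F_{i_1}>u_1t,\dots,F_{i_k}>u_kt)\sim\mathbb E\Big[\min\Big\{\frac{(AK^{1/\alpha}1)_{i_1}}{u_1},\dots,\frac{(AK^{1/\alpha}1)_{i_k}}{u_k}\Big\}^\alpha\Big]\,t^{-\alpha}$$ if they are asymptotically fully dependent. 3. $P(\|F\|>t)\sim Ct^{-\alpha}$, with $C=C^S_{ind}=\sum_{j=1}^dK_j\,\mathbb E\|Ae_j\|^\alpha$ if $V_1,\dots,V_d$ are asymptotically independent, and $C=C^S_{dep}=\mathbb E\|AK^{1/\alpha}1\|^\alpha$ if they are asymptotically fully dependent. -/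

import Mathlib

open MeasureTheory ProbabilityTheory Filter Topology Asymptotics Matrix
open scoped ENNReal

noncomputable section

/-- The punctured cone `[0,∞]^d \ {0}`. Its subspace topology is the one-point uncompactification:
the compact sets are the compact sets of `[0,∞]^d` that do not contain `0`. -/
abbrev PuncturedCone (d : ℕ) : Type := {x : Fin d → ℝ≥0∞ // x ≠ 0}

/-- Vague convergence of measures on the punctured cone: the integrals of all continuous functions
with compact support converge. -/
def VagueTendsto {d : ℕ} (νs : ℕ → Measure (PuncturedCone d)) (ν : Measure (PuncturedCone d)) :
    Prop :=
  ∀ f : CompactlySupportedContinuousMap (PuncturedCone d) ℝ,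
    Tendsto (fun n => ∫ x, f x ∂(νs n)) atTop (𝓝 (∫ x, f x ∂ν))

/-- The law of a random vector with nonnegative real entries, viewed as a measure on the punctured
cone (the mass at the origin is dropped): `S ↦ P(X ∈ S)`. -/
def lawOnCone {Ω : Type*} [MeasurableSpace Ω] {d : ℕ} (P : Measure Ω) (X : Ω → Fin d → ℝ) :
    Measure (PuncturedCone d) :=
  (P.map (fun ω j => ENNReal.ofReal (X ω j))).comap Subtype.val

/-- `ν` is the exponent measure of the nonnegative random vector `X` for the normalization
`b_n = n^{1/α}`: a nonzero Radon measure on the punctured cone such that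
`n P(X / n^{1/α} ∈ ·)` converges vaguely to `ν`. That such a `ν` exists means that `X` is
multivariate regularly varying with index `α` (in this normalization). -/
structure IsExponentMeasure {Ω : Type*} [MeasurableSpace Ω] {d : ℕ} (P : Measure Ω)
    (X : Ω → Fin d → ℝ) (α : ℝ) (ν : Measure (PuncturedCone d)) : Prop where
  radon : IsFiniteMeasureOnCompacts ν
  ne_zero : ν ≠ 0
  tendsto : VagueTendsto
    (fun n => (n : ℝ≥0∞) • lawOnCone P (fun ω j => X ω j / (n : ℝ) ^ (1 / α))) ν

/-- The union of the coordinate axes: at most one coordinate is nonzero. -/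
def axes (d : ℕ) : Set (PuncturedCone d) := {x | ∃ j, ∀ l, l ≠ j → x.1 l = 0}

/-- The vector `K^{1/α} 1 = (K_1^{1/α}, …, K_d^{1/α})`. -/
def scaleVec {d : ℕ} (K : Fin d → ℝ) (α : ℝ) : Fin d → ℝ := fun j => K j ^ (1 / α)

/-- The open half-line `{s K^{1/α} 1 : s > 0}`. -/
def scaleRay {d : ℕ} (K : Fin d → ℝ) (α : ℝ) : Set (PuncturedCone d) :=
  {x | ∃ s : ℝ, 0 < s ∧ ∀ j, x.1 j = ENNReal.ofReal (s * scaleVec K α j)}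

/-- Asymptotic independence: `X` is multivariate regularly varying with index `α`, and its exponent
measure has mass only on the axes. -/
def AsymptoticallyIndependent {Ω : Type*} [MeasurableSpace Ω] {d : ℕ} (P : Measure Ω)
    (X : Ω → Fin d → ℝ) (α : ℝ) : Prop :=
  ∃ ν : Measure (PuncturedCone d), IsExponentMeasure P X α ν ∧ ν (axes d)ᶜ = 0

/-- Asymptotic full dependence: `X` is multivariate regularly varying with index `α`, and its
exponent measure has mass only on the half-line `{s K^{1/α} 1 : s > 0}`. -/
def AsymptoticallyFullyDependent {Ω : Type*} [MeasurableSpace Ω] {d : ℕ} (P : Measure Ω)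
    (X : Ω → Fin d → ℝ) (K : Fin d → ℝ) (α : ℝ) : Prop :=
  ∃ ν : Measure (PuncturedCone d), IsExponentMeasure P X α ν ∧ ν (scaleRay K α)ᶜ = 0

/-- The weighted adjacency matrix `A_{ij} = 1(i ∼ j) W_{ij}` of a random bipartite graph between
agents `i` and objects `j`; `E i j` is the event `i ∼ j`. -/
def weightedAdjacency {Ω : Type*} {q d : ℕ} (E : Fin q → Fin d → Set Ω)
    (W : Fin q → Fin d → Ω → ℝ) (ω : Ω) : Matrix (Fin q) (Fin d) ℝ :=
  Matrix.of fun i j => (E i j).indicator (W i j) ω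

/-- The vector of exposures `F = A V`. -/
def exposure {Ω : Type*} {q d : ℕ} (A : Ω → Matrix (Fin q) (Fin d) ℝ) (V : Ω → Fin d → ℝ)
    (ω : Ω) : Fin q → ℝ :=
  A ω *ᵥ V ω

/-- The tail asymptotics `f(t) ∼ C t^{-α}` as `t → ∞`, for `C ≥ 0`: the function `t^α f(t)` tends
to `C`. For `C ≠ 0` this is the same as `f(t) / (C t^{-α}) → 1`, which is recorded as well; for
`C = 0` it says that `f(t) = o(t^{-α})`. -/
def TailAsymp (f : ℝ → ℝ) (C α : ℝ) : Prop :=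
  Tendsto (fun t => t ^ α * f t) atTop (𝓝 C) ∧
    (C ≠ 0 → f ~[atTop] fun t => C * t ^ (-α))

end

/-! Each exceedance event has the form `t < G (A V)` with `G` positively homogeneous and Lipschitz:
a coordinate, the minimum of `y i / u i`, or the norm. For a fixed matrix `a`, the map `h x = G (a
x)` is of the same kind (`HomLipschitz.mulVec`), so it suffices to treat such an `h` and then
average over `A`.

The exponent measure `ν` is only used to show that certain events have probability `o(t^{-α})`: a
continuous `g` that vanishes at the origin and `ν`-almost everywhere is rarely bounded below
(`IsExponentMeasure.tendsto_rpow_mul_real`). All limiting constants come from the marginal tails.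

Under independence two claims rarely exceed `δt` together. Otherwise `h V` is within order `δt` of
`h(e_j) V_j` for a single `j`, and the tails of these products add up
(`HomLipschitz.tendsto_of_pair`). Under full dependence the claims `V_j / K_j^{1/α}`, truncated at
level `Mt`, rarely differ by `δt`. Hence `h V` is close to `h(K^{1/α}1) S`, where `S` is one
normalized claim with tail `t^{-α}` (`HomLipschitz.tendsto_of_dependent`).

Independence of `A` and `V` allows conditioning on `A`, and dominated convergence moves the limit
inside the expectation; the dominating function is a multiple of `(∑ |A i j|)^α`
(`HomLipschitz.tailAsymp_of_forall`). -/

/-! ### From vague convergence to negligible events -/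

/-- A nonnegative continuous function of `[0,∞]^d` vanishing near the origin gives a compactly
supported function on the punctured cone. -/
theorem hasCompactSupport_posPart_sub {d : ℕ} {g : (Fin d → ℝ≥0∞) → ℝ} (hg : Continuous g)
    (hg0 : g 0 = 0) {δ : ℝ} (hδ : 0 < δ) :
    HasCompactSupport (fun x : PuncturedCone d => max (g x.1 - δ) 0) := by
  -- `[0,∞]^d` is compact, so a closed subset that misses the origin is compact in the cone.
  have hc : IsCompact {x : PuncturedCone d | δ ≤ g x.1} := by
    rw [Subtype.isCompact_iff]
    have : (Subtype.val '' {x : PuncturedCone d | δ ≤ g x.1}) = {x | δ ≤ g x} := by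
      ext x
      simp only [Set.mem_image, Set.mem_ofPred_eq, Subtype.exists, exists_and_right, exists_eq_right]
      refine ⟨fun ⟨_, h⟩ => h, fun h => ⟨?_, h⟩⟩
      rintro rfl
      linarith
    rw [this]
    exact (isClosed_le continuous_const hg).isCompact
  refine HasCompactSupport.intro hc fun x hx => ?_
  simp only [Set.mem_ofPred_eq, not_le] at hx
  exact max_eq_right (by linarith)

theorem measurableEmbedding_coe_puncturedCone (d : ℕ) :
    MeasurableEmbedding (Subtype.val : PuncturedCone d → Fin d → ℝ≥0∞) :=
  MeasurableEmbedding.subtype_coe (measurableSet_singleton 0).compl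

theorem lawOnCone_real_preimage {Ω : Type*} [MeasurableSpace Ω] {d : ℕ} (P : Measure Ω)
    {X : Ω → Fin d → ℝ} (hX : Measurable X) {s : Set (Fin d → ℝ≥0∞)} (hs : MeasurableSet s)
    (h0 : (0 : Fin d → ℝ≥0∞) ∉ s) :
    (lawOnCone P X).real (Subtype.val ⁻¹' s) =
      P.real {ω | (fun j => ENNReal.ofReal (X ω j)) ∈ s} := by
  have hm : Measurable fun ω (j : Fin d) => ENNReal.ofReal (X ω j) := by fun_prop
  have hemb := measurableEmbedding_coe_puncturedCone d
  have hs0 : s ⊆ Set.range (Subtype.val : PuncturedCone d → Fin d → ℝ≥0∞) := by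
    intro x hx
    refine ⟨⟨x, ?_⟩, rfl⟩
    rintro rfl
    exact h0 hx
  rw [Measure.real, Measure.real, lawOnCone, hemb.comap_apply,
    Set.image_preimage_eq_of_subset hs0, Measure.map_apply hm hs]
  rfl

instance isFiniteMeasure_lawOnCone {Ω : Type*} [MeasurableSpace Ω] {d : ℕ} (P : Measure Ω)
    [IsFiniteMeasure P] (X : Ω → Fin d → ℝ) : IsFiniteMeasure (lawOnCone P X) := by
  have hemb := measurableEmbedding_coe_puncturedCone d
  refine ⟨?_⟩
  rw [lawOnCone, hemb.comap_apply]
  exact measure_lt_top _ _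

/-- Along the integers, sets on which a continuous function vanishing `ν`-almost everywhere is
bounded below have asymptotically negligible probability. -/
theorem IsExponentMeasure.tendsto_nat_mul_real {Ω : Type*} [MeasurableSpace Ω] {P : Measure Ω}
    [IsProbabilityMeasure P] {d : ℕ} {V : Ω → Fin d → ℝ} (hVm : Measurable V) {α : ℝ}
    {ν : Measure (PuncturedCone d)} (hν : IsExponentMeasure P V α ν)
    {g : (Fin d → ℝ≥0∞) → ℝ} (hg : Continuous g) (hg0 : g 0 = 0)
    (hgν : ∀ᵐ x ∂ν, g x.1 = 0) {δ : ℝ} (hδ : 0 < δ) :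
    Tendsto (fun n : ℕ => (n : ℝ) *
      P.real {ω | δ ≤ g fun j => ENNReal.ofReal (V ω j / (n : ℝ) ^ (1 / α))}) atTop (𝓝 0) := by
  have hδ2 : 0 < δ / 2 := by positivity
  -- Cutting at `δ / 2` keeps the support away from the origin and leaves `f ≥ δ / 2` on `{g ≥ δ}`,
  -- as Markov's inequality needs.
  let f : CompactlySupportedContinuousMap (PuncturedCone d) ℝ :=
    ⟨⟨fun x => max (g x.1 - δ / 2) 0, by fun_prop⟩, hasCompactSupport_posPart_sub hg hg0 hδ2⟩
  have hf : ∀ x, f x = max (g x.1 - δ / 2) 0 := fun _ => rfl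
  have h := hν.tendsto f
  have hz : ∫ x, f x ∂ν = 0 := by
    refine integral_eq_zero_of_ae ?_
    filter_upwards [hgν] with x hx
    rw [hf, hx]
    exact max_eq_right (by linarith)
  rw [hz] at h
  have h' := h.const_mul (2 / δ)
  rw [mul_zero] at h'
  refine squeeze_zero (fun n => by positivity) (fun n => ?_) h'
  have hX : Measurable fun ω (j : Fin d) => V ω j / (n : ℝ) ^ (1 / α) := by fun_prop
  have hs : MeasurableSet {x : Fin d → ℝ≥0∞ | δ ≤ g x} :=
    measurableSet_le measurable_const hg.measurable
  have key := lawOnCone_real_preimage P hX hs (by simp [hg0, hδ])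
  have hint : Integrable f (lawOnCone P fun ω j => V ω j / (n : ℝ) ^ (1 / α)) :=
    f.continuous.integrable_of_hasCompactSupport f.hasCompactSupport
  have markov := mul_meas_ge_le_integral_of_nonneg (ae_of_all _ fun x => by
    rw [hf]; exact le_max_right _ _) hint (δ / 2)
  have hmono : (lawOnCone P fun ω j => V ω j / (n : ℝ) ^ (1 / α)).real
      (Subtype.val ⁻¹' {x : Fin d → ℝ≥0∞ | δ ≤ g x}) ≤
      (lawOnCone P fun ω j => V ω j / (n : ℝ) ^ (1 / α)).real {x | δ / 2 ≤ f x} := by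
    refine measureReal_mono fun x hx => ?_
    have hx' : δ ≤ g x.1 := hx
    show δ / 2 ≤ f x
    rw [hf]
    exact le_max_of_le_left (by linarith)
  rw [key] at hmono
  rw [integral_smul_measure, ENNReal.toReal_natCast, smul_eq_mul, mul_left_comm]
  refine mul_le_mul_of_nonneg_left (hmono.trans ?_) (Nat.cast_nonneg n)
  rw [div_mul_eq_mul_div, le_div_iff₀ hδ]
  linarith

/-- The continuous version of `IsExponentMeasure.tendsto_nat_mul_real`. -/
theorem IsExponentMeasure.tendsto_rpow_mul_real {Ω : Type*} [MeasurableSpace Ω] {P : Measure Ω}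
    [IsProbabilityMeasure P] {d : ℕ} {V : Ω → Fin d → ℝ} (hVm : Measurable V) {α : ℝ}
    (hα : 0 < α) {ν : Measure (PuncturedCone d)} (hν : IsExponentMeasure P V α ν)
    {g : (Fin d → ℝ≥0∞) → ℝ} (hg : Continuous g) (hg0 : g 0 = 0)
    (hgν : ∀ᵐ x ∂ν, g x.1 = 0) {δ : ℝ} (hδ : 0 < δ) {S : ℝ → Set Ω}
    (hS : ∀ t r : ℝ, 0 < t → 1 ≤ r → r ≤ 2 ^ (1 / α) → ∀ ω ∈ S t,
      δ ≤ g fun j => ENNReal.ofReal (r * (V ω j / t))) :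
    Tendsto (fun t => t ^ α * P.real (S t)) atTop (𝓝 0) := by
  have h := hν.tendsto_nat_mul_real hVm hg hg0 hgν hδ
  -- With `n = ⌊t^α⌋` one has `n ≤ t^α ≤ 2n`, so `t / n^{1/α}` lies in `[1, 2^{1/α}]`; this ratio is
  -- the `r` of `hS`.
  have hfl : Tendsto (fun t : ℝ => ⌊t ^ α⌋₊) atTop atTop :=
    tendsto_nat_floor_atTop.comp (tendsto_rpow_atTop hα)
  have h2 := (h.comp hfl).const_mul 2
  rw [mul_zero] at h2
  refine squeeze_zero' ?_ ?_ h2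
  · filter_upwards [eventually_gt_atTop 0] with t ht
    positivity
  · filter_upwards [eventually_ge_atTop 1] with t ht
    have ht0 : 0 < t := by linarith
    have h1 : 1 ≤ t ^ α := Real.one_le_rpow ht hα.le
    have hn1 : 1 ≤ ⌊t ^ α⌋₊ := Nat.one_le_floor_iff _ |>.2 h1
    have hn1' : (1 : ℝ) ≤ (⌊t ^ α⌋₊ : ℝ) := by exact_mod_cast hn1
    have hle : (⌊t ^ α⌋₊ : ℝ) ≤ t ^ α := Nat.floor_le (by linarith)
    have hlt : t ^ α < ⌊t ^ α⌋₊ + 1 := Nat.lt_floor_add_one _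
    simp only [Function.comp_apply]
    generalize (⌊t ^ α⌋₊ : ℕ) = n at *
    have hn0 : (0 : ℝ) < n := by linarith
    have hb0 : 0 < (n : ℝ) ^ (1 / α) := by positivity
    have htt : (t ^ α) ^ (1 / α) = t := by
      rw [← Real.rpow_mul ht0.le, mul_one_div_cancel hα.ne', Real.rpow_one]
    have hr1 : 1 ≤ t / (n : ℝ) ^ (1 / α) := by
      rw [le_div_iff₀ hb0, one_mul]
      calc (n : ℝ) ^ (1 / α) ≤ (t ^ α) ^ (1 / α) := by gcongr
        _ = t := htt
    have hr2 : t / (n : ℝ) ^ (1 / α) ≤ 2 ^ (1 / α) := by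
      rw [div_le_iff₀ hb0, ← Real.mul_rpow (by norm_num) hn0.le]
      calc t = (t ^ α) ^ (1 / α) := htt.symm
        _ ≤ (2 * (n : ℝ)) ^ (1 / α) := by gcongr; linarith
    have hsub : S t ⊆ {ω | δ ≤ g fun j => ENNReal.ofReal (V ω j / (n : ℝ) ^ (1 / α))} := by
      intro ω hω
      have := hS t _ ht0 hr1 hr2 ω hω
      have heq : ∀ v : ℝ, t / (n : ℝ) ^ (1 / α) * (v / t) = v / (n : ℝ) ^ (1 / α) := by
        intro v
        field_simp
      simp only [heq] at this
      exact this
    calc t ^ α * P.real (S t) ≤ (2 * n) * P.real (S t) := by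
          gcongr; linarith
      _ ≤ (2 * n) * P.real {ω | δ ≤ g fun j => ENNReal.ofReal (V ω j / (n : ℝ) ^ (1 / α))} := by
          gcongr
          exact measure_ne_top _ _
      _ = _ := by ring

/-! ### Pair estimates for the two dependence regimes -/

/-- The truncation `x ↦ min x T` as a real number. -/
noncomputable def truncReal (T : ℝ) (x : ℝ≥0∞) : ℝ := (min x (ENNReal.ofReal T)).toReal

theorem continuous_truncReal (T : ℝ) : Continuous (truncReal T) :=
  ENNReal.continuousOn_toReal.comp_continuous (by fun_prop)
    fun x => ne_top_of_le_ne_top ENNReal.ofReal_ne_top (min_le_right x _)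

theorem truncReal_zero (T : ℝ) : truncReal T 0 = 0 := by simp [truncReal]

theorem truncReal_ofReal {T x : ℝ} (hT : 0 ≤ T) (hx : 0 ≤ x) :
    truncReal T (ENNReal.ofReal x) = min x T := by
  rw [truncReal, ← ENNReal.ofReal_min, ENNReal.toReal_ofReal (le_min hx hT)]

/-- Under asymptotic independence two claims are rarely large together. -/
theorem AsymptoticallyIndependent.tendsto_pair {Ω : Type*} [MeasurableSpace Ω] {P : Measure Ω}
    [IsProbabilityMeasure P] {d : ℕ} {V : Ω → Fin d → ℝ} (hVm : Measurable V)
    {α : ℝ} (hα : 0 < α) (h : AsymptoticallyIndependent P V α) {j l : Fin d} (hjl : j ≠ l)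
    {δ : ℝ} (hδ : 0 < δ) :
    Tendsto (fun t => t ^ α * P.real {ω | δ * t < V ω j ∧ δ * t < V ω l}) atTop (𝓝 0) := by
  obtain ⟨ν, hν, hax⟩ := h
  -- Truncation at 1 keeps `g` real-valued and continuous at infinite coordinates, at the price of
  -- `min δ 1` for `δ`. On an axis one of the two coordinates is zero.
  refine hν.tendsto_rpow_mul_real hVm hα
    (g := fun x => min (truncReal 1 (x j)) (truncReal 1 (x l))) ?_ ?_ ?_ (δ := min δ 1)
    (by positivity) ?_
  · exact ((continuous_truncReal 1).comp (continuous_apply j)).min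
      ((continuous_truncReal 1).comp (continuous_apply l))
  · simp [truncReal_zero]
  · have hae : ∀ᵐ x ∂ν, x ∈ axes d := hax
    filter_upwards [hae] with x ⟨m, hm⟩
    rcases eq_or_ne j m with rfl | hj
    · rw [hm l hjl.symm, truncReal_zero]
      exact min_eq_right ENNReal.toReal_nonneg
    · rw [hm j hj, truncReal_zero]
      exact min_eq_left ENNReal.toReal_nonneg
  · rintro t r ht hr - ω ⟨h1, h2⟩
    have aux : ∀ v : ℝ, δ * t < v → min δ 1 ≤ truncReal 1 (ENNReal.ofReal (r * (v / t))) := by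
      intro v hv
      have h3 : δ ≤ v / t := by rw [le_div_iff₀ ht]; exact hv.le
      have h4 : δ ≤ r * (v / t) := by nlinarith
      rw [truncReal_ofReal zero_le_one (by linarith)]
      exact min_le_min_right _ h4
    exact le_min (aux _ h1) (aux _ h2)

theorem scaleVec_pos {d : ℕ} {K : Fin d → ℝ} (hK : ∀ j, 0 < K j) (α : ℝ) (j : Fin d) :
    0 < scaleVec K α j := Real.rpow_pos_of_pos (hK j) _

/-- Under full asymptotic dependence two truncated normalized claims are rarely far apart. -/
theorem AsymptoticallyFullyDependent.tendsto_pair {Ω : Type*} [MeasurableSpace Ω] {P : Measure Ω}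
    [IsProbabilityMeasure P] {d : ℕ} {V : Ω → Fin d → ℝ} (hVm : Measurable V)
    (hV0 : ∀ ω j, 0 ≤ V ω j) {K : Fin d → ℝ} (hK : ∀ j, 0 < K j)
    {α : ℝ} (hα : 0 < α) (h : AsymptoticallyFullyDependent P V K α) (j l : Fin d)
    {δ M : ℝ} (hδ : 0 < δ) (hM : 0 < M) :
    Tendsto (fun t => t ^ α * P.real {ω | δ * t ≤
      |min (V ω j / scaleVec K α j) (M * t) - min (V ω l / scaleVec K α l) (M * t)|})
      atTop (𝓝 0) := by
  obtain ⟨ν, hν, hray⟩ := h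
  have hk := scaleVec_pos hK α
  set k := scaleVec K α
  -- `T` bounds `r * M` for every admissible `r`, so a single `g`, truncated at `T`, serves all of
  -- them.
  set T : ℝ := 2 ^ (1 / α) * M with hT
  have hT0 : 0 < T := by positivity
  have htr : ∀ (m : Fin d) (x : ℝ), 0 ≤ x →
      truncReal (T * k m) (ENNReal.ofReal x) / k m = min (x / k m) T := by
    intro m x hx
    rw [truncReal_ofReal (mul_pos hT0 (hk m)).le hx, ← min_div_div_right (hk m).le,
      mul_div_cancel_right₀ _ (hk m).ne']
  refine hν.tendsto_rpow_mul_real hVm hα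
    (g := fun x => |truncReal (T * k j) (x j) / k j - truncReal (T * k l) (x l) / k l|)
    ?_ ?_ ?_ hδ ?_
  · have := fun m : Fin d => (continuous_truncReal (T * k m)).comp
      (continuous_apply (A := fun _ : Fin d => ℝ≥0∞) m)
    exact (((this j).div_const _).sub ((this l).div_const _)).abs
  · simp [truncReal_zero]
  · have hae : ∀ᵐ x ∂ν, x ∈ scaleRay K α := hray
    filter_upwards [hae] with x ⟨s, hs, hx⟩
    rw [hx j, hx l, htr j _ (mul_pos hs (hk j)).le, htr l _ (mul_pos hs (hk l)).le,
      mul_div_cancel_right₀ _ (hk j).ne', mul_div_cancel_right₀ _ (hk l).ne', sub_self, abs_zero]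
  · rintro t r ht hr hr2 ω hω
    have hr0 : 0 < r := by linarith
    have hv : ∀ m, 0 ≤ r * (V ω m / t) := fun m =>
      mul_nonneg hr0.le (div_nonneg (hV0 ω m) ht.le)
    dsimp only
    rw [htr j _ (hv j), htr l _ (hv l)]
    have hrM : r * M ≤ T := by rw [hT]; gcongr
    have aux : ∀ m, min (min (r * (V ω m / t) / k m) T) (r * M) =
        r / t * min (V ω m / k m) (M * t) := by
      intro m
      rw [min_assoc, min_eq_right hrM, mul_min_of_nonneg _ _ (by positivity : 0 ≤ r / t)]
      congr 1 <;> field_simp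
    -- Truncating further, from `T` down to `r * M`, cannot increase a difference.
    have h1 := abs_min_sub_min_le_max (min (r * (V ω j / t) / k j) T) (r * M)
      (min (r * (V ω l / t) / k l) T) (r * M)
    rw [aux j, aux l, sub_self, abs_zero, max_eq_left (abs_nonneg _), ← mul_sub, abs_mul,
      abs_of_pos (by positivity : 0 < r / t)] at h1
    refine le_trans ?_ h1
    have h2 : δ * t ≤ |min (V ω j / k j) (M * t) - min (V ω l / k l) (M * t)| := hω
    calc δ ≤ r * δ := by nlinarith
      _ = r / t * (δ * t) := by field_simp
      _ ≤ _ := by gcongr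

/-! ### Calculus of power tails -/

/-- Handles the iterated limit, `t → ∞` and then `ε ↓ 0`: the bounds may depend on `ε`, and only
their limits must approach `C`. -/
theorem tendsto_of_sandwich {f U L : ℝ → ℝ} {C : ℝ} (hU : Tendsto U (𝓝[>] 0) (𝓝 C))
    (hL : Tendsto L (𝓝[>] 0) (𝓝 C))
    (hu : ∀ ε ∈ Set.Ioo (0 : ℝ) 1, ∃ u : ℝ → ℝ, Tendsto u atTop (𝓝 (U ε)) ∧
      ∀ᶠ t in atTop, f t ≤ u t)
    (hl : ∀ ε ∈ Set.Ioo (0 : ℝ) 1, ∃ l : ℝ → ℝ, Tendsto l atTop (𝓝 (L ε)) ∧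
      ∀ᶠ t in atTop, l t ≤ f t) :
    Tendsto f atTop (𝓝 C) := by
  have hIoo : ∀ᶠ ε : ℝ in 𝓝[>] 0, ε ∈ Set.Ioo (0 : ℝ) 1 := Ioo_mem_nhdsGT one_pos
  refine tendsto_order.2 ⟨fun a ha => ?_, fun a ha => ?_⟩
  · obtain ⟨ε, h1, h2⟩ := ((hL.eventually_const_lt ha).and hIoo).exists
    obtain ⟨l, h3, h4⟩ := hl ε h2
    filter_upwards [h4, h3.eventually_const_lt h1] with t h5 h6
    linarith
  · obtain ⟨ε, h1, h2⟩ := ((hU.eventually_lt_const ha).and hIoo).exists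
    obtain ⟨u, h3, h4⟩ := hu ε h2
    filter_upwards [h4, h3.eventually_lt_const h1] with t h5 h6
    linarith

theorem tendsto_rpow_mul_of_isEquivalent {f : ℝ → ℝ} {C α : ℝ}
    (h : f ~[atTop] fun t => C * t ^ (-α)) :
    Tendsto (fun t => t ^ α * f t) atTop (𝓝 C) := by
  have h1 := (IsEquivalent.refl (u := fun t : ℝ => t ^ α) (l := atTop)).mul h
  refine (IsEquivalent.tendsto_nhds_iff h1).2 ?_
  refine tendsto_const_nhds.congr' ?_
  filter_upwards [eventually_gt_atTop 0] with t ht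
  simp only [Pi.mul_apply]
  rw [mul_left_comm, ← Real.rpow_add ht, add_neg_cancel, Real.rpow_zero, mul_one]

theorem TailAsymp.of_tendsto {f : ℝ → ℝ} {C α : ℝ}
    (h : Tendsto (fun t => t ^ α * f t) atTop (𝓝 C)) : TailAsymp f C α := by
  refine ⟨h, fun hC => ?_⟩
  have h1 : (fun t => t ^ α * f t) ~[atTop] fun _ => C := (isEquivalent_const_iff_tendsto hC).2 h
  have h2 := h1.mul (IsEquivalent.refl (u := fun t : ℝ => t ^ (-α)) (l := atTop))
  refine (h2.congr_left ?_)
  filter_upwards [eventually_gt_atTop 0] with t ht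
  simp only [Pi.mul_apply]
  rw [mul_right_comm, ← Real.rpow_add ht, add_neg_cancel, Real.rpow_zero, one_mul]

/-- Regular variation of the tail of a multiple of a random variable. -/
theorem tendsto_rpow_mul_real_lt_mul {Ω : Type*} [MeasurableSpace Ω] {P : Measure Ω}
    {X : Ω → ℝ} {κ α : ℝ} (hα : 0 < α)
    (hX : Tendsto (fun t => t ^ α * P.real {ω | t < X ω}) atTop (𝓝 κ)) {c x : ℝ} (hc : 0 ≤ c)
    (hx : 0 < x) :
    Tendsto (fun t => t ^ α * P.real {ω | x * t < c * X ω}) atTop (𝓝 (κ * (c / x) ^ α)) := by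
  rcases hc.eq_or_lt with rfl | hc
  · rw [zero_div, Real.zero_rpow hα.ne', mul_zero]
    refine tendsto_const_nhds.congr' ?_
    filter_upwards [eventually_gt_atTop 0] with t ht
    have : ¬ x * t < 0 := by have := mul_pos hx ht; linarith
    simp [this]
  · have h1 : Tendsto (fun t : ℝ => x / c * t) atTop atTop :=
      tendsto_id.const_mul_atTop (by positivity)
    have h2 := (hX.comp h1).mul_const ((c / x) ^ α)
    refine h2.congr' ?_
    filter_upwards [eventually_gt_atTop 0] with t ht
    have hset : {ω | x / c * t < X ω} = {ω | x * t < c * X ω} := by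
      ext ω
      show x / c * t < X ω ↔ x * t < c * X ω
      rw [div_mul_eq_mul_div, div_lt_iff₀ hc, mul_comm (X ω)]
    simp only [Function.comp_apply]
    rw [hset, mul_right_comm, ← Real.mul_rpow (by positivity) (by positivity)]
    congr 2
    field_simp

/-- A tail of order `t^{-α}` is bounded by a multiple of `t^{-α}` for all `t > 0`. -/
theorem exists_rpow_mul_real_le {Ω : Type*} [MeasurableSpace Ω] {P : Measure Ω}
    [IsProbabilityMeasure P] {X : Ω → ℝ} {κ α : ℝ} (hα : 0 < α)
    (hX : Tendsto (fun t => t ^ α * P.real {ω | t < X ω}) atTop (𝓝 κ)) :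
    ∃ B, 0 ≤ B ∧ ∀ t, 0 < t → t ^ α * P.real {ω | t < X ω} ≤ B := by
  obtain ⟨t₀, h⟩ := eventually_atTop.1 (hX.eventually_le_const (lt_add_one κ))
  -- Below `t₀` the probability is bounded by 1; the absolute value covers a negative `t₀`.
  refine ⟨max (κ + 1) (|t₀| ^ α), le_max_of_le_right (by positivity), fun t ht => ?_⟩
  rcases le_total t₀ t with h1 | h1
  · exact le_max_of_le_left (h t h1)
  · refine le_max_of_le_right ?_
    calc t ^ α * P.real {ω | t < X ω} ≤ t ^ α * 1 := by
          gcongr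
          exact measureReal_le_one
      _ ≤ |t₀| ^ α := by
          rw [mul_one]
          gcongr
          exact h1.trans (le_abs_self _)

/-! ### Tails of homogeneous Lipschitz functionals of the claims -/

/-- A positively homogeneous functional that is Lipschitz for the `ℓ¹` norm. -/
structure HomLipschitz {ι : Type*} [Fintype ι] (h : (ι → ℝ) → ℝ) (L : ℝ) : Prop where
  lip : ∀ x y, |h x - h y| ≤ L * ∑ j, |x j - y j|
  hom : ∀ (s : ℝ) (x : ι → ℝ), 0 ≤ s → h (s • x) = s * h x

namespace HomLipschitz

variable {ι : Type*} [Fintype ι] {h : (ι → ℝ) → ℝ} {L : ℝ}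

theorem map_zero (H : HomLipschitz h L) : h 0 = 0 := by
  have := H.hom 0 0 le_rfl
  simpa using this

theorem abs_le (H : HomLipschitz h L) (x : ι → ℝ) : |h x| ≤ L * ∑ j, |x j| := by
  simpa [H.map_zero] using H.lip x 0

theorem map_single [DecidableEq ι] (H : HomLipschitz h L) (j : ι) {s : ℝ} (hs : 0 ≤ s) :
    h (Pi.single j s) = s * h (Pi.single j 1) := by
  rw [← H.hom s _ hs, ← Pi.single_smul', smul_eq_mul, mul_one]

theorem map_single_le [DecidableEq ι] (H : HomLipschitz h L) (j : ι) :
    h (Pi.single j 1) ≤ L := by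
  have h1 := (le_abs_self _).trans (H.abs_le (Pi.single j 1))
  have h2 : ∑ l, |(Pi.single j (1 : ℝ) : ι → ℝ) l| = 1 := by
    rw [Finset.sum_eq_single j] <;> simp +contextual
  rwa [h2, mul_one] at h1

end HomLipschitz

theorem tendsto_one_sub_nhdsGT : Tendsto (fun ε : ℝ => 1 - ε) (𝓝[>] 0) (𝓝 1) := by
  have : Tendsto (fun ε : ℝ => 1 - ε) (𝓝 0) (𝓝 (1 - 0)) := tendsto_const_nhds.sub tendsto_id
  rw [sub_zero] at this
  exact this.mono_left nhdsWithin_le_nhds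

theorem tendsto_one_add_nhdsGT : Tendsto (fun ε : ℝ => 1 + ε) (𝓝[>] 0) (𝓝 1) := by
  have : Tendsto (fun ε : ℝ => 1 + ε) (𝓝 0) (𝓝 (1 + 0)) := tendsto_const_nhds.add tendsto_id
  rw [add_zero] at this
  exact this.mono_left nhdsWithin_le_nhds

theorem tendsto_mul_div_rpow {ι : Type*} {l : Filter ι} {φ : ι → ℝ} (hφ : Tendsto φ l (𝓝 1))
    (κ c : ℝ) {α : ℝ} (hα : 0 < α) :
    Tendsto (fun ε => κ * (c / φ ε) ^ α) l (𝓝 (κ * c ^ α)) := by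
  have h1 : Tendsto (fun ε => c / φ ε) l (𝓝 (c / 1)) := tendsto_const_nhds.div hφ one_ne_zero
  rw [div_one] at h1
  exact (h1.rpow_const (Or.inr hα.le)).const_mul κ

section

variable {Ω : Type*} [MeasurableSpace Ω] {P : Measure Ω} [IsFiniteMeasure P] {d : ℕ}
  {V : Ω → Fin d → ℝ} {α : ℝ} {K : Fin d → ℝ} {h : (Fin d → ℝ) → ℝ} {L : ℝ}

/-- The single big jump principle for a fixed Lipschitz functional: if two claims are rarely large
together, then the functional is large because of one claim. -/
theorem HomLipschitz.tendsto_of_pair (H : HomLipschitz h L) (hL : 0 ≤ L)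
    (hpos : ∀ j, 0 ≤ h (Pi.single j 1)) (hα : 0 < α) (hVm : Measurable V)
    (hV0 : ∀ ω j, 0 ≤ V ω j)
    (hV : ∀ j, Tendsto (fun t => t ^ α * P.real {ω | t < V ω j}) atTop (𝓝 (K j)))
    (hpair : ∀ j l, j ≠ l → ∀ δ : ℝ, 0 < δ →
      Tendsto (fun t => t ^ α * P.real {ω | δ * t < V ω j ∧ δ * t < V ω l}) atTop (𝓝 0)) :
    Tendsto (fun t => t ^ α * P.real {ω | t < h (V ω)}) atTop
      (𝓝 (∑ j, K j * h (Pi.single j 1) ^ α)) := by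
  classical
  let pairs : Finset (Fin d × Fin d) := Finset.univ.filter fun p => p.1 ≠ p.2
  let bad : ℝ → ℝ → Set Ω := fun δ t =>
    ⋃ p ∈ pairs, {ω | δ * t < V ω p.1 ∧ δ * t < V ω p.2}
  have hbad : ∀ δ : ℝ, 0 < δ →
      Tendsto (fun t => t ^ α * P.real (bad δ t)) atTop (𝓝 0) := by
    intro δ hδ
    have h1 : Tendsto (fun t => ∑ p ∈ pairs,
        t ^ α * P.real {ω | δ * t < V ω p.1 ∧ δ * t < V ω p.2}) atTop (𝓝 (∑ p ∈ pairs, 0)) :=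
      tendsto_finsetSum _ fun p hp => hpair p.1 p.2 (Finset.mem_filter.1 hp).2 δ hδ
    rw [Finset.sum_const_zero] at h1
    refine squeeze_zero' ?_ ?_ h1
    · filter_upwards [eventually_gt_atTop 0] with t ht
      positivity
    · filter_upwards [eventually_gt_atTop 0] with t ht
      rw [← Finset.mul_sum]
      gcongr
      exact measureReal_biUnion_finset_le _ _
  have hmem : ∀ {δ t : ℝ} {ω : Ω} {j l : Fin d}, ω ∉ bad δ t → j ≠ l → δ * t < V ω j →
      V ω l ≤ δ * t := by
    intro δ t ω j l hω hjl hj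
    by_contra hl
    exact hω (Set.mem_iUnion₂.2 ⟨(j, l), by simp [pairs, hjl], hj, not_le.1 hl⟩)
  have hmeas_lt : ∀ (x c : ℝ) (j : Fin d), MeasurableSet {ω | x < c * V ω j} := fun x c j =>
    measurableSet_lt measurable_const (by fun_prop)
  have hmeas_bad : ∀ δ t, MeasurableSet (bad δ t) := fun δ t =>
    Finset.measurableSet_biUnion _ fun p _ =>
      measurableSet_setOfPred.2 <|
        (measurableSet_setOfPred.1 (measurableSet_lt measurable_const (hVm.eval (a := p.1)))).and
          (measurableSet_setOfPred.1 (measurableSet_lt measurable_const (hVm.eval (a := p.2))))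
  -- when all coordinates but one are small, the functional only sees this coordinate
  have hone : ∀ {δ t : ℝ} {ω : Ω} (j : Fin d), (∀ l, l ≠ j → V ω l ≤ δ * t) → 0 ≤ δ * t →
      |h (V ω) - h (Pi.single j 1) * V ω j| ≤ L * (d * (δ * t)) := by
    intro δ t ω j hj hδt
    rw [mul_comm (h _), ← H.map_single j (hV0 ω j)]
    refine (H.lip _ _).trans (mul_le_mul_of_nonneg_left ?_ hL)
    calc ∑ l, |V ω l - (Pi.single j (V ω j) : Fin d → ℝ) l| ≤ ∑ _l : Fin d, δ * t := by
          refine Finset.sum_le_sum fun l _ => ?_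
          rcases eq_or_ne l j with rfl | hl
          · simpa using hδt
          · rw [Pi.single_eq_of_ne hl, sub_zero, abs_of_nonneg (hV0 ω l)]
            exact hj l hl
      _ = d * (δ * t) := by simp
  -- The bound on `L * (d * δ)` controls the error from the small claims; the bound on `L * δ`
  -- forces `V ω j > δ * t` in `hlarge`. The `+ 1` in the denominator covers `L = 0`.
  have hδ : ∀ ε : ℝ, 0 < ε → ∃ δ : ℝ, 0 < δ ∧ L * (d * δ) ≤ ε ∧ L * δ ≤ ε := by
    intro ε hε
    have hpos : 0 < L * (d + 1) + 1 := by positivity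
    have h2 : 0 < ε / (L * (d + 1) + 1) := by positivity
    have h1 : L * (d + 1) * (ε / (L * (d + 1) + 1)) ≤ ε := by
      rw [mul_div_assoc', div_le_iff₀ hpos]
      nlinarith
    have hLd : 0 ≤ L * (d * (ε / (L * (d + 1) + 1))) := by positivity
    have hL1 : 0 ≤ L * (ε / (L * (d + 1) + 1)) := by positivity
    exact ⟨_, h2, by nlinarith, by nlinarith⟩
  refine tendsto_of_sandwich
    (U := fun ε => ∑ j, K j * (h (Pi.single j 1) / (1 - ε)) ^ α)
    (L := fun ε => ∑ j, K j * (h (Pi.single j 1) / (1 + ε)) ^ α)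
    (tendsto_finsetSum _ fun j _ => tendsto_mul_div_rpow tendsto_one_sub_nhdsGT _ _ hα)
    (tendsto_finsetSum _ fun j _ => tendsto_mul_div_rpow tendsto_one_add_nhdsGT _ _ hα)
    (fun ε hε => ?_) (fun ε hε => ?_)
  · obtain ⟨δ, hδ0, hδ1, hδ2⟩ := hδ ε hε.1
    refine ⟨fun t => (∑ j, t ^ α * P.real {ω | (1 - ε) * t < h (Pi.single j 1) * V ω j}) +
      t ^ α * P.real (bad δ t), ?_, ?_⟩
    · have h1 := (tendsto_finsetSum Finset.univ fun j _ => tendsto_rpow_mul_real_lt_mul hα (hV j)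
        (hpos j) (by linarith [hε.2] : 0 < 1 - ε)).add (hbad δ hδ0)
      rwa [add_zero] at h1
    · filter_upwards [eventually_gt_atTop 0] with t ht
      have hδt : 0 ≤ δ * t := by positivity
      have hsmall : L * (d * (δ * t)) ≤ ε * t := by
        calc L * (d * (δ * t)) = L * (d * δ) * t := by ring
          _ ≤ ε * t := by gcongr
      have hsub : {ω | t < h (V ω)} ⊆
          (⋃ j ∈ (Finset.univ : Finset (Fin d)),
            {ω | (1 - ε) * t < h (Pi.single j 1) * V ω j}) ∪ bad δ t := by
        intro ω hω
        have hω' : t < h (V ω) := hω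
        by_cases hb : ω ∈ bad δ t
        · exact Or.inr hb
        refine Or.inl ?_
        by_cases hex : ∃ j, δ * t < V ω j
        · obtain ⟨j, hj⟩ := hex
          refine Set.mem_iUnion₂.2 ⟨j, Finset.mem_univ j, ?_⟩
          show (1 - ε) * t < h (Pi.single j 1) * V ω j
          have := _root_.abs_le.1 (hone j (fun l hl => hmem hb hl.symm hj) hδt)
          nlinarith [this.2]
        -- If every claim is at most `δ * t`, then `h (V ω) ≤ ε * t < t`.
        · push Not at hex
          exfalso
          have h1 := (le_abs_self _).trans (H.abs_le (V ω))
          have h2 : ∑ l, |V ω l| ≤ d * (δ * t) := by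
            calc ∑ l, |V ω l| ≤ ∑ _l : Fin d, δ * t :=
                  Finset.sum_le_sum fun l _ => by rw [abs_of_nonneg (hV0 ω l)]; exact hex l
              _ = d * (δ * t) := by simp
          have h3 : L * ∑ l, |V ω l| ≤ L * (d * (δ * t)) := by gcongr
          nlinarith [hε.2]
      calc t ^ α * P.real {ω | t < h (V ω)}
          ≤ t ^ α * ((∑ j, P.real {ω | (1 - ε) * t < h (Pi.single j 1) * V ω j}) +
              P.real (bad δ t)) := by
            gcongr
            refine (measureReal_mono hsub).trans ((measureReal_union_le _ _).trans ?_)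
            gcongr
            exact measureReal_biUnion_finset_le _ _
        _ = _ := by rw [mul_add, Finset.mul_sum]
  · obtain ⟨δ, hδ0, hδ1, hδ2⟩ := hδ ε hε.1
    refine ⟨fun t => (∑ j, t ^ α * P.real {ω | (1 + ε) * t < h (Pi.single j 1) * V ω j}) -
      d * (t ^ α * P.real (bad δ t)), ?_, ?_⟩
    · have h1 := (tendsto_finsetSum Finset.univ fun j _ => tendsto_rpow_mul_real_lt_mul hα (hV j)
        (hpos j) (by linarith [hε.1] : 0 < 1 + ε)).sub ((hbad δ hδ0).const_mul (d : ℝ))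
      rwa [mul_zero, sub_zero] at h1
    · filter_upwards [eventually_gt_atTop 0] with t ht
      have hδt : 0 ≤ δ * t := by positivity
      have hsmall : L * (d * (δ * t)) ≤ ε * t := by
        calc L * (d * (δ * t)) = L * (d * δ) * t := by ring
          _ ≤ ε * t := by gcongr
      let B : Fin d → Set Ω := fun j => {ω | (1 + ε) * t < h (Pi.single j 1) * V ω j}
      have hlarge : ∀ j, ∀ ω ∈ B j, δ * t < V ω j := by
        intro j ω hω
        have hω' : (1 + ε) * t < h (Pi.single j 1) * V ω j := hω
        by_contra hlt
        have h1 : h (Pi.single j 1) * V ω j ≤ L * (δ * t) :=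
          mul_le_mul (H.map_single_le j) (not_lt.1 hlt) (hV0 ω j) hL
        have h2 : L * (δ * t) ≤ ε * t := by
          calc L * (δ * t) = L * δ * t := by ring
            _ ≤ ε * t := by gcongr
        nlinarith
      -- Outside `bad` at most one claim exceeds `δ * t`, so the events are disjoint and their
      -- probabilities add. Each loses at most `P.real (bad δ t)`, hence the factor `d`.
      have hdisj : (↑(Finset.univ : Finset (Fin d)) : Set (Fin d)).PairwiseDisjoint
          (fun j => B j \ bad δ t) := by
        intro j _ l _ hjl
        refine Set.disjoint_left.2 fun ω hj hl => ?_
        exact absurd (hmem hj.2 hjl (hlarge j ω hj.1)) (not_le.2 (hlarge l ω hl.1))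
      have hsub : (⋃ j ∈ (Finset.univ : Finset (Fin d)), B j \ bad δ t) ⊆ {ω | t < h (V ω)} := by
        intro ω hω
        obtain ⟨j, -, hj, hb⟩ := Set.mem_iUnion₂.1 hω
        have hj' : (1 + ε) * t < h (Pi.single j 1) * V ω j := hj
        have := _root_.abs_le.1 (hone j (fun l hl => hmem hb hl.symm (hlarge j ω hj)) hδt)
        show t < h (V ω)
        nlinarith [this.1]
      have hsum : ∑ j, P.real (B j \ bad δ t) ≤ P.real {ω | t < h (V ω)} := by
        rw [← measureReal_biUnion_finset hdisj
          (fun j _ => (hmeas_lt _ _ j).diff (hmeas_bad _ _))]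
        exact measureReal_mono hsub
      have hB : ∀ j, P.real (B j) ≤ P.real (B j \ bad δ t) + P.real (bad δ t) := by
        intro j
        refine (measureReal_mono ?_).trans (measureReal_union_le _ _)
        intro ω hω
        by_cases hb : ω ∈ bad δ t
        · exact Or.inr hb
        · exact Or.inl ⟨hω, hb⟩
      have hsumB : ∑ j, P.real (B j) ≤ P.real {ω | t < h (V ω)} + d * P.real (bad δ t) := by
        refine (Finset.sum_le_sum fun j _ => hB j).trans ?_
        rw [Finset.sum_add_distrib]
        simpa using hsum
      rw [sub_le_iff_le_add, ← Finset.mul_sum]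
      calc t ^ α * ∑ j, P.real (B j)
          ≤ t ^ α * (P.real {ω | t < h (V ω)} + d * P.real (bad δ t)) := by gcongr
        _ = _ := by ring

theorem scaleVec_rpow (hα : 0 < α) (hK : ∀ j, 0 < K j) (j : Fin d) :
    scaleVec K α j ^ α = K j := by
  rw [scaleVec, ← Real.rpow_mul (hK j).le, one_div_mul_cancel hα.ne', Real.rpow_one]

/-- If truncated normalized claims are rarely far apart, then a Lipschitz functional is large
because all claims are large in the fixed proportion. -/
theorem HomLipschitz.tendsto_of_dependent (H : HomLipschitz h L) (hL : 0 ≤ L)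
    (hpos : 0 ≤ h (scaleVec K α)) (hα : 0 < α) (hK : ∀ j, 0 < K j) (hV0 : ∀ ω j, 0 ≤ V ω j)
    (hV : ∀ j, Tendsto (fun t => t ^ α * P.real {ω | t < V ω j}) atTop (𝓝 (K j)))
    (hpair : ∀ (j l : Fin d) (δ M : ℝ), 0 < δ → 0 < M →
      Tendsto (fun t => t ^ α * P.real {ω | δ * t ≤
        |min (V ω j / scaleVec K α j) (M * t) - min (V ω l / scaleVec K α l) (M * t)|})
        atTop (𝓝 0)) (j₀ : Fin d) :
    Tendsto (fun t => t ^ α * P.real {ω | t < h (V ω)}) atTop (𝓝 (h (scaleVec K α) ^ α)) := by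
  have hk := scaleVec_pos hK α
  have hkα := scaleVec_rpow hα hK
  set k := scaleVec K α
  let S : Ω → ℝ := fun ω => V ω j₀ / k j₀
  have hS0 : ∀ ω, 0 ≤ S ω := fun ω => div_nonneg (hV0 ω j₀) (hk j₀).le
  have hStail : Tendsto (fun t => t ^ α * P.real {ω | t < S ω}) atTop (𝓝 1) := by
    have h1 := tendsto_rpow_mul_real_lt_mul hα (hV j₀) zero_le_one (hk j₀)
    rw [Real.div_rpow zero_le_one (hk j₀).le, hkα, Real.one_rpow,
      mul_one_div_cancel (hK j₀).ne'] at h1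
    refine h1.congr fun t => ?_
    congr 3
    ext ω
    show k j₀ * t < 1 * V ω j₀ ↔ t < V ω j₀ / k j₀
    rw [lt_div_iff₀ (hk j₀), one_mul, mul_comm]
  let D : Fin d → ℝ → ℝ → ℝ → Set Ω := fun l δ M t =>
    {ω | δ * t ≤ |min (V ω j₀ / k j₀) (M * t) - min (V ω l / k l) (M * t)|}
  -- The margin in `M + δ` removes the truncation: when `S ω ≤ M * t`, a normalized claim above `(M
  -- + δ) * t` would make the truncated difference at least `δ * t`.
  let bad : ℝ → ℝ → ℝ → Set Ω := fun δ M t =>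
    {ω | M * t < 1 * S ω} ∪ ⋃ l ∈ (Finset.univ : Finset (Fin d)), D l δ (M + δ) t
  have hbad_le : ∀ δ M t : ℝ, 0 < t → t ^ α * P.real (bad δ M t) ≤
      t ^ α * P.real {ω | M * t < 1 * S ω} + ∑ l, t ^ α * P.real (D l δ (M + δ) t) := by
    intro δ M t ht
    rw [← Finset.mul_sum, ← mul_add]
    gcongr
    refine (measureReal_union_le _ _).trans ?_
    gcongr
    exact measureReal_biUnion_finset_le _ _
  have hbad : ∀ δ M : ℝ, 0 < δ → 0 < M → Tendsto
      (fun t => t ^ α * P.real {ω | M * t < 1 * S ω} + ∑ l, t ^ α * P.real (D l δ (M + δ) t))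
      atTop (𝓝 ((1 / M) ^ α)) := by
    intro δ M hδ hM
    have h1 := (tendsto_rpow_mul_real_lt_mul hα hStail zero_le_one hM).add
      (tendsto_finsetSum Finset.univ fun l _ => hpair j₀ l δ (M + δ) hδ (by linarith))
    simpa using h1
  have hgood : ∀ {δ M t : ℝ} {ω : Ω}, 0 < δ → 0 < t → ω ∉ bad δ M t →
      |h (V ω) - h k * S ω| ≤ L * (∑ l, k l) * δ * t := by
    intro δ M t ω hδ ht hω
    have hSM : S ω ≤ M * t := by
      by_contra hlt
      exact hω (Or.inl (by simpa using hlt))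
    have hclose : ∀ l, |V ω l / k l - S ω| ≤ δ * t := by
      intro l
      have h1 : |min (S ω) ((M + δ) * t) - min (V ω l / k l) ((M + δ) * t)| < δ * t := by
        by_contra hlt
        exact hω (Or.inr (Set.mem_iUnion₂.2 ⟨l, Finset.mem_univ l, not_lt.1 hlt⟩))
      have hδt : 0 < δ * t := by positivity
      rw [min_eq_left (by nlinarith)] at h1
      have h2 : V ω l / k l ≤ (M + δ) * t := by
        by_contra hlt
        rw [min_eq_right (not_le.1 hlt).le] at h1
        have := (abs_lt.1 h1).1
        nlinarith
      rw [min_eq_left h2, abs_sub_comm] at h1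
      exact h1.le
    rw [mul_comm (h k), ← H.hom _ _ (hS0 ω)]
    refine (H.lip _ _).trans ?_
    rw [mul_assoc, mul_assoc]
    refine mul_le_mul_of_nonneg_left ?_ hL
    rw [Finset.sum_mul]
    refine Finset.sum_le_sum fun l _ => ?_
    have h3 : V ω l - (S ω • k) l = k l * (V ω l / k l - S ω) := by
      rw [Pi.smul_apply, smul_eq_mul, mul_sub, mul_div_cancel₀ _ (hk l).ne', mul_comm (S ω)]
    rw [h3, abs_mul, abs_of_pos (hk l)]
    exact mul_le_mul_of_nonneg_left (hclose l) (hk l).le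
  have hδ : ∀ ε : ℝ, 0 < ε → ∃ δ : ℝ, 0 < δ ∧ L * (∑ l, k l) * δ ≤ ε := by
    intro ε hε
    have hs : 0 ≤ L * ∑ l, k l := mul_nonneg hL (Finset.sum_nonneg fun l _ => (hk l).le)
    refine ⟨ε / (L * (∑ l, k l) + 1), by positivity, ?_⟩
    rw [mul_div_assoc', div_le_iff₀ (by positivity)]
    nlinarith
  -- With `M = ε⁻¹` the bad event contributes `ε ^ α` in the limit in `t`, which vanishes with `ε`.
  have hεα : Tendsto (fun ε : ℝ => (1 / ε⁻¹) ^ α) (𝓝[>] 0) (𝓝 0) := by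
    simp only [one_div, inv_inv]
    have := (continuous_id.rpow_const fun _ => Or.inr hα.le : Continuous fun ε : ℝ => ε ^ α)
    have h0 : Tendsto (fun ε : ℝ => ε ^ α) (𝓝 0) (𝓝 (0 ^ α)) := this.tendsto 0
    rw [Real.zero_rpow hα.ne'] at h0
    exact h0.mono_left nhdsWithin_le_nhds
  have hU := (tendsto_mul_div_rpow tendsto_one_sub_nhdsGT 1 (h k) hα).add hεα
  have hLo := (tendsto_mul_div_rpow tendsto_one_add_nhdsGT 1 (h k) hα).sub hεα
  rw [one_mul, add_zero] at hU
  rw [one_mul, sub_zero] at hLo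
  refine tendsto_of_sandwich hU hLo (fun ε hε => ?_) (fun ε hε => ?_)
  · obtain ⟨δ, hδ0, hδ1⟩ := hδ ε hε.1
    refine ⟨_, (tendsto_rpow_mul_real_lt_mul hα hStail hpos
      (by linarith [hε.2] : 0 < 1 - ε)).add (hbad δ ε⁻¹ hδ0 (inv_pos.2 hε.1)), ?_⟩
    filter_upwards [eventually_gt_atTop 0] with t ht
    refine le_trans ?_ (add_le_add_right (hbad_le δ ε⁻¹ t ht) _)
    rw [← mul_add]
    gcongr
    refine (measureReal_mono ?_).trans (measureReal_union_le _ _)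
    intro ω hω
    have hω' : t < h (V ω) := hω
    by_cases hb : ω ∈ bad δ ε⁻¹ t
    · exact Or.inr hb
    · refine Or.inl ?_
      show (1 - ε) * t < h k * S ω
      have h1 := (_root_.abs_le.1 (hgood hδ0 ht hb)).2
      nlinarith
  · obtain ⟨δ, hδ0, hδ1⟩ := hδ ε hε.1
    refine ⟨_, (tendsto_rpow_mul_real_lt_mul hα hStail hpos
      (by linarith [hε.1] : 0 < 1 + ε)).sub (hbad δ ε⁻¹ hδ0 (inv_pos.2 hε.1)), ?_⟩
    filter_upwards [eventually_gt_atTop 0] with t ht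
    rw [sub_le_iff_le_add]
    refine le_trans ?_ (add_le_add_right (hbad_le δ ε⁻¹ t ht) _)
    rw [← mul_add]
    gcongr
    refine (measureReal_mono ?_).trans (measureReal_union_le _ _)
    intro ω hω
    have hω' : (1 + ε) * t < h k * S ω := hω
    by_cases hb : ω ∈ bad δ ε⁻¹ t
    · exact Or.inr hb
    · refine Or.inl ?_
      show t < h (V ω)
      have h1 := (_root_.abs_le.1 (hgood hδ0 ht hb)).1
      nlinarith

end

/-! ### Random matrices: conditioning and domination -/

/-- Conditioning on one of two independent random variables. -/
theorem IndepFun.real_eq_integral {Ω β γ : Type*} [MeasurableSpace Ω] [MeasurableSpace β]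
    [MeasurableSpace γ] {P : Measure Ω} [IsProbabilityMeasure P] {X : Ω → β} {Y : Ω → γ}
    (hX : Measurable X) (hY : Measurable Y) (hXY : IndepFun X Y P) {s : Set (β × γ)}
    (hs : MeasurableSet s) :
    Measurable (fun ω => P.real {ω' | (X ω, Y ω') ∈ s}) ∧
      P.real {ω | (X ω, Y ω) ∈ s} = ∫ ω, P.real {ω' | (X ω, Y ω') ∈ s} ∂P := by
  have := Measure.isProbabilityMeasure_map (μ := P) hY.aemeasurable
  have := Measure.isProbabilityMeasure_map (μ := P) hX.aemeasurable
  have h1 : ∀ b, P.map Y (Prod.mk b ⁻¹' s) = P {ω' | (b, Y ω') ∈ s} := fun b =>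
    Measure.map_apply hY (measurable_prodMk_left hs)
  have hm : Measurable fun b => P.real {ω' | (b, Y ω') ∈ s} := by
    have h2 := (measurable_measure_prodMk_left (ν := P.map Y) hs).ennreal_toReal
    simp only [h1] at h2
    exact h2
  refine ⟨hm.comp hX, ?_⟩
  have h3 := (indepFun_iff_map_prod_eq_prod_map_map hX.aemeasurable hY.aemeasurable).1 hXY
  calc P.real {ω | (X ω, Y ω) ∈ s} = (P.map fun ω => (X ω, Y ω)).real s := by
        rw [map_measureReal_apply (hX.prodMk hY) hs]
        rfl
    _ = ((P.map X).prod (P.map Y)).real s := by rw [h3]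
    _ = ∫ b, P.real {ω' | (b, Y ω') ∈ s} ∂(P.map X) := by
        rw [Measure.real, Measure.prod_apply hs,
          ← integral_toReal (measurable_measure_prodMk_left hs).aemeasurable
            (ae_of_all _ fun b => measure_lt_top _ _)]
        simp only [h1]
        rfl
    _ = _ := integral_map hX.aemeasurable hm.aestronglyMeasurable

theorem HomLipschitz.continuous {ι : Type*} [Fintype ι] {h : (ι → ℝ) → ℝ} {L : ℝ}
    (H : HomLipschitz h L) : Continuous h := by
  refine continuous_iff_continuousAt.2 fun x => ?_
  rw [ContinuousAt, tendsto_iff_dist_tendsto_zero]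
  have h1 : Continuous fun y : ι → ℝ => L * ∑ j, |y j - x j| := by fun_prop
  have h2 := h1.tendsto x
  simp only [sub_self, abs_zero, Finset.sum_const_zero, mul_zero] at h2
  exact squeeze_zero (fun _ => dist_nonneg) (fun y => H.lip y x) h2

/-- The constant is crude but explicit in the entries of `a`, so for random `a` its `α`-th power can
be integrated. -/
theorem HomLipschitz.mulVec {q d : ℕ} {G : (Fin q → ℝ) → ℝ} {C : ℝ} (H : HomLipschitz G C)
    (hC : 0 ≤ C) (a : Matrix (Fin q) (Fin d) ℝ) :
    HomLipschitz (fun x => G (a *ᵥ x)) (C * ∑ p : Fin q × Fin d, |a p.1 p.2|) where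
  lip x y := by
    refine (H.lip _ _).trans ?_
    rw [mul_assoc]
    refine mul_le_mul_of_nonneg_left ?_ hC
    rw [Fintype.sum_prod_type, Finset.sum_mul]
    refine Finset.sum_le_sum fun i _ => ?_
    have h1 : (a *ᵥ x) i - (a *ᵥ y) i = ∑ j, a i j * (x j - y j) := by
      simp only [Matrix.mulVec, dotProduct, mul_sub, Finset.sum_sub_distrib]
    rw [h1, Finset.sum_mul]
    refine (Finset.abs_sum_le_sum_abs _ _).trans (Finset.sum_le_sum fun j _ => ?_)
    rw [abs_mul]
    exact mul_le_mul_of_nonneg_left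
      (Finset.single_le_sum (f := fun j => |x j - y j|) (fun _ _ => abs_nonneg _)
        (Finset.mem_univ j)) (abs_nonneg _)
  hom s x hs := by
    rw [Matrix.mulVec_smul, H.hom _ _ hs]

/-- The sum is at most the cardinality times the largest term. Unlike a convexity bound, this works
for `α < 1` too. -/
theorem rpow_sum_le_card_rpow_mul_sum {ι : Type*} (s : Finset ι) {f : ι → ℝ}
    (hf : ∀ i ∈ s, 0 ≤ f i) {α : ℝ} (hα : 0 < α) :
    (∑ i ∈ s, f i) ^ α ≤ (s.card : ℝ) ^ α * ∑ i ∈ s, f i ^ α := by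
  rcases s.eq_empty_or_nonempty with rfl | hs
  · simp [Real.zero_rpow hα.ne']
  · obtain ⟨m, hm, hmax⟩ := s.exists_max_image f hs
    calc (∑ i ∈ s, f i) ^ α ≤ (s.card * f m) ^ α := by
          refine Real.rpow_le_rpow (Finset.sum_nonneg hf) ?_ hα.le
          simpa using Finset.sum_le_sum hmax
      _ = (s.card : ℝ) ^ α * f m ^ α := Real.mul_rpow (Nat.cast_nonneg _) (hf m hm)
      _ ≤ _ := by
          gcongr
          exact Finset.single_le_sum (f := fun i => f i ^ α)
            (fun i hi => Real.rpow_nonneg (hf i hi) _) hm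

/-- If `h (V ω) > t`, some claim exceeds `t / (d * L)`. The bound is uniform in `t` and provides the
dominating function. -/
theorem HomLipschitz.rpow_mul_real_le {Ω : Type*} [MeasurableSpace Ω] {P : Measure Ω}
    [IsFiniteMeasure P] {d : ℕ} {V : Ω → Fin d → ℝ} {α : ℝ} {h : (Fin d → ℝ) → ℝ} {L : ℝ}
    (H : HomLipschitz h L) (hL : 0 ≤ L) (hV0 : ∀ ω j, 0 ≤ V ω j) {B : Fin d → ℝ}
    (hB0 : ∀ j, 0 ≤ B j)
    (hB : ∀ j t, 0 < t → t ^ α * P.real {ω | t < V ω j} ≤ B j) {t : ℝ} (ht : 0 < t) :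
    t ^ α * P.real {ω | t < h (V ω)} ≤ (d * L) ^ α * ∑ j, B j := by
  have hle : ∀ ω, h (V ω) ≤ L * ∑ j, V ω j := fun ω => by
    refine (le_abs_self _).trans ((H.abs_le _).trans_eq ?_)
    simp only [abs_of_nonneg (hV0 ω _)]
  have hs0 : 0 ≤ ∑ j, B j := Finset.sum_nonneg fun j _ => hB0 j
  rcases (by positivity : 0 ≤ (d : ℝ) * L).eq_or_lt with h0 | hdL
  · have hempty : {ω | t < h (V ω)} = ∅ := by
      refine Set.eq_empty_of_forall_notMem fun ω (hω : t < h (V ω)) => ?_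
      have h1 := hle ω
      rcases mul_eq_zero.1 h0.symm with h2 | h2
      · have : d = 0 := by exact_mod_cast h2
        subst this
        simp only [Finset.univ_eq_empty, Finset.sum_empty, mul_zero] at h1
        linarith
      · rw [h2, zero_mul] at h1
        linarith
    rw [hempty, measureReal_empty, mul_zero]
    positivity
  · have hsub : {ω | t < h (V ω)} ⊆
        ⋃ j ∈ (Finset.univ : Finset (Fin d)), {ω | t / (d * L) < V ω j} := by
      intro ω hω
      have hω' : t < h (V ω) := hω
      by_contra hnot
      have hall : ∀ j, V ω j ≤ t / (d * L) := by
        intro j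
        by_contra hlt
        exact hnot (Set.mem_iUnion₂.2 ⟨j, Finset.mem_univ j, not_le.1 hlt⟩)
      have h1 : ∑ j, V ω j ≤ d * (t / (d * L)) := by
        simpa using Finset.sum_le_sum fun j (_ : j ∈ Finset.univ) => hall j
      have h2 : L * ∑ j, V ω j ≤ L * (d * (t / (d * L))) := by gcongr
      have h3 : L * (d * (t / (d * L))) = t := by
        rw [← mul_assoc, mul_comm L, mul_div_cancel₀ _ hdL.ne']
      linarith [hle ω]
    have ht' : 0 < t / (d * L) := by positivity
    have htα : t ^ α = (d * L) ^ α * (t / (d * L)) ^ α := by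
      rw [← Real.mul_rpow hdL.le ht'.le, mul_div_cancel₀ _ hdL.ne']
    calc t ^ α * P.real {ω | t < h (V ω)}
        ≤ t ^ α * ∑ j, P.real {ω | t / (d * L) < V ω j} := by
          gcongr
          exact (measureReal_mono hsub (measure_ne_top _ _)).trans (measureReal_biUnion_finset_le _ _)
      _ = (d * L) ^ α * ∑ j, (t / (d * L)) ^ α * P.real {ω | t / (d * L) < V ω j} := by
          rw [htα, Finset.mul_sum, Finset.mul_sum]
          exact Finset.sum_congr rfl fun j _ => by ring
      _ ≤ _ := by
          gcongr with j
          exact hB j _ ht'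

section

variable {Ω : Type*} [MeasurableSpace Ω] {P : Measure Ω} {q d : ℕ}
  {V : Ω → Fin d → ℝ} {α : ℝ} {K : Fin d → ℝ} {A : Ω → Matrix (Fin q) (Fin d) ℝ}
  {G : (Fin q → ℝ) → ℝ} {C : ℝ}

theorem integrable_rpow_mul_sum_abs (hα : 0 < α) (hA0 : ∀ ω i j, 0 ≤ A ω i j)
    (hAm : ∀ i j, Measurable fun ω => A ω i j)
    (hAint : ∀ i j, Integrable (fun ω => A ω i j ^ α) P) {c : ℝ} (hc : 0 ≤ c) :
    Integrable (fun ω => (c * ∑ p : Fin q × Fin d, |A ω p.1 p.2|) ^ α) P := by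
  have h1 : Integrable (fun ω => c ^ α * (((Finset.univ : Finset (Fin q × Fin d)).card : ℝ) ^ α *
      ∑ p : Fin q × Fin d, A ω p.1 p.2 ^ α)) P :=
    ((integrable_finsetSum _ fun p _ => hAint p.1 p.2).const_mul _).const_mul _
  refine h1.mono' ?_ (ae_of_all _ fun ω => ?_)
  · have : Measurable fun ω => ∑ p : Fin q × Fin d, |A ω p.1 p.2| :=
      Finset.measurable_sum _ fun p _ => (hAm p.1 p.2).abs
    exact ((this.const_mul c).pow_const α).aestronglyMeasurable
  · have hs : 0 ≤ ∑ p : Fin q × Fin d, |A ω p.1 p.2| :=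
      Finset.sum_nonneg fun p _ => abs_nonneg _
    rw [Real.norm_of_nonneg (by positivity), Real.mul_rpow hc hs]
    gcongr
    simp only [abs_of_nonneg (hA0 ω _ _)]
    exact rpow_sum_le_card_rpow_mul_sum _ (fun p _ => hA0 ω _ _) hα

theorem mulVec_apply_nonneg {a : Matrix (Fin q) (Fin d) ℝ} (ha : ∀ i j, 0 ≤ a i j)
    {x : Fin d → ℝ} (hx : ∀ j, 0 ≤ x j) (i : Fin q) : 0 ≤ (a *ᵥ x) i := by
  rw [Matrix.mulVec, dotProduct]
  exact Finset.sum_nonneg fun j _ => mul_nonneg (ha i j) (hx j)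

/-- Passing from a fixed matrix to a random matrix independent of the claims, by dominated
convergence. -/
theorem HomLipschitz.tailAsymp_of_forall [IsProbabilityMeasure P]
    (H : HomLipschitz G C) (hC : 0 ≤ C) (hα : 0 < α)
    (hVm : Measurable V) (hV0 : ∀ ω j, 0 ≤ V ω j)
    (hV : ∀ j, Tendsto (fun t => t ^ α * P.real {ω | t < V ω j}) atTop (𝓝 (K j)))
    (hA0 : ∀ ω i j, 0 ≤ A ω i j) (hAm : ∀ i j, Measurable fun ω => A ω i j)
    (hAint : ∀ i j, Integrable (fun ω => A ω i j ^ α) P)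
    (hindep : IndepFun (fun ω (p : Fin q × Fin d) => A ω p.1 p.2) V P) {c : Ω → ℝ}
    (hc : ∀ ω, Tendsto (fun t => t ^ α * P.real {ω' | t < G (A ω *ᵥ V ω')}) atTop (𝓝 (c ω))) :
    TailAsymp (fun t => P.real {ω | t < G (exposure A V ω)}) (∫ ω, c ω ∂P) α := by
  have hX : Measurable fun ω (p : Fin q × Fin d) => A ω p.1 p.2 :=
    measurable_pi_lambda _ fun p => hAm p.1 p.2
  have hcont : Continuous fun z : (Fin q × Fin d → ℝ) × (Fin d → ℝ) =>
      G (Matrix.of (fun i j => z.1 (i, j)) *ᵥ z.2) := by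
    refine H.continuous.comp (continuous_pi fun i => ?_)
    simp only [Matrix.mulVec, dotProduct, Matrix.of_apply]
    fun_prop
  have hset : ∀ t : ℝ, MeasurableSet {z : (Fin q × Fin d → ℝ) × (Fin d → ℝ) |
      t < G (Matrix.of (fun i j => z.1 (i, j)) *ᵥ z.2)} := fun t =>
    measurableSet_lt measurable_const hcont.measurable
  have hcond := fun t => IndepFun.real_eq_integral hX hVm hindep (hset t)
  -- Tail bounds are needed for all positive arguments: they are applied at `t / (d * L)` with `L`
  -- depending on `A ω`, which may be small however large `t` is.
  choose B hB0 hB using fun j => exists_rpow_mul_real_le hα (hV j)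
  refine TailAsymp.of_tendsto ?_
  have hlim : Tendsto (fun t => ∫ ω, t ^ α * P.real {ω' | t < G (A ω *ᵥ V ω')} ∂P) atTop
      (𝓝 (∫ ω, c ω ∂P)) := by
    refine tendsto_integral_filter_of_dominated_convergence
      (fun ω => (d * C * ∑ p : Fin q × Fin d, |A ω p.1 p.2|) ^ α * ∑ j, B j) ?_ ?_ ?_ ?_
    · exact Eventually.of_forall fun t => ((hcond t).1.const_mul _).aestronglyMeasurable
    · filter_upwards [eventually_gt_atTop 0] with t ht
      refine ae_of_all _ fun ω => ?_
      have hL : 0 ≤ C * ∑ p : Fin q × Fin d, |A ω p.1 p.2| :=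
        mul_nonneg hC (Finset.sum_nonneg fun p _ => abs_nonneg _)
      rw [Real.norm_of_nonneg (by positivity), mul_assoc (d : ℝ)]
      exact (H.mulVec hC (A ω)).rpow_mul_real_le hL hV0 hB0 hB ht
    · exact (integrable_rpow_mul_sum_abs hα hA0 hAm hAint (by positivity)).mul_const _
    · exact ae_of_all _ hc
  refine hlim.congr fun t => ?_
  rw [integral_const_mul]
  exact congrArg _ (hcond t).2.symm

/-- Tail of a Lipschitz functional of the exposures under asymptotic independence. -/
theorem HomLipschitz.tailAsymp_of_asymptoticallyIndependent [IsProbabilityMeasure P]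
    (H : HomLipschitz G C) (hC : 0 ≤ C)
    (hG : ∀ y, (∀ i, 0 ≤ y i) → 0 ≤ G y) (hα : 0 < α)
    (hVm : Measurable V) (hV0 : ∀ ω j, 0 ≤ V ω j)
    (hV : ∀ j, Tendsto (fun t => t ^ α * P.real {ω | t < V ω j}) atTop (𝓝 (K j)))
    (hA0 : ∀ ω i j, 0 ≤ A ω i j) (hAm : ∀ i j, Measurable fun ω => A ω i j)
    (hAint : ∀ i j, Integrable (fun ω => A ω i j ^ α) P)
    (hindep : IndepFun (fun ω (p : Fin q × Fin d) => A ω p.1 p.2) V P)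
    (h : AsymptoticallyIndependent P V α) :
    TailAsymp (fun t => P.real {ω | t < G (exposure A V ω)})
      (∑ j, K j * ∫ ω, G (A ω *ᵥ Pi.single j 1) ^ α ∂P) α := by
  have hpos : ∀ ω j, 0 ≤ G (A ω *ᵥ Pi.single j 1) := fun ω j => hG _
    (mulVec_apply_nonneg (hA0 ω) fun l =>
      (Pi.single_nonneg.2 zero_le_one : (0 : Fin d → ℝ) ≤ Pi.single j 1) l)
  have hL : ∀ ω, 0 ≤ C * ∑ p : Fin q × Fin d, |A ω p.1 p.2| := fun ω =>
    mul_nonneg hC (Finset.sum_nonneg fun p _ => abs_nonneg _)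
  have hint : ∀ j, Integrable (fun ω => G (A ω *ᵥ Pi.single j 1) ^ α) P := by
    intro j
    refine (integrable_rpow_mul_sum_abs hα hA0 hAm hAint hC).mono' ?_ (ae_of_all _ fun ω => ?_)
    · have h1 : Measurable fun ω => A ω *ᵥ (Pi.single j 1 : Fin d → ℝ) := by
        refine measurable_pi_lambda _ fun i => ?_
        simp only [Matrix.mulVec, dotProduct]
        exact Finset.measurable_sum _ fun l _ => (hAm i l).mul_const _
      exact ((H.continuous.measurable.comp h1).pow_const α).aestronglyMeasurable
    · rw [Real.norm_of_nonneg (Real.rpow_nonneg (hpos ω j) _)]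
      exact Real.rpow_le_rpow (hpos ω j) ((H.mulVec hC (A ω)).map_single_le j) hα.le
  have h1 := H.tailAsymp_of_forall hC hα hVm hV0 hV hA0 hAm hAint hindep fun ω =>
    (H.mulVec hC (A ω)).tendsto_of_pair (hL ω) (hpos ω) hα hVm hV0 hV
      fun j l hjl δ hδ => h.tendsto_pair hVm hα hjl hδ
  rw [integral_finsetSum _ fun j _ => (hint j).const_mul _] at h1
  simpa only [integral_const_mul] using h1

/-- Tail of a Lipschitz functional of the exposures under asymptotic full dependence. -/
theorem HomLipschitz.tailAsymp_of_asymptoticallyFullyDependent [IsProbabilityMeasure P]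
    (H : HomLipschitz G C)
    (hC : 0 ≤ C) (hG : ∀ y, (∀ i, 0 ≤ y i) → 0 ≤ G y) (hα : 0 < α) (hK : ∀ j, 0 < K j)
    (hVm : Measurable V) (hV0 : ∀ ω j, 0 ≤ V ω j)
    (hV : ∀ j, Tendsto (fun t => t ^ α * P.real {ω | t < V ω j}) atTop (𝓝 (K j)))
    (hA0 : ∀ ω i j, 0 ≤ A ω i j) (hAm : ∀ i j, Measurable fun ω => A ω i j)
    (hAint : ∀ i j, Integrable (fun ω => A ω i j ^ α) P)
    (hindep : IndepFun (fun ω (p : Fin q × Fin d) => A ω p.1 p.2) V P)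
    (h : AsymptoticallyFullyDependent P V K α) :
    TailAsymp (fun t => P.real {ω | t < G (exposure A V ω)})
      (∫ ω, G (A ω *ᵥ scaleVec K α) ^ α ∂P) α := by
  have hL : ∀ ω, 0 ≤ C * ∑ p : Fin q × Fin d, |A ω p.1 p.2| := fun ω =>
    mul_nonneg hC (Finset.sum_nonneg fun p _ => abs_nonneg _)
  -- For `d = 0` the cone is empty and could not carry a nonzero measure.
  obtain ⟨j₀⟩ : Nonempty (Fin d) := by
    obtain ⟨ν, hν, -⟩ := h
    by_contra hd
    rw [not_nonempty_iff] at hd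
    have : IsEmpty (PuncturedCone d) := ⟨fun x => x.2 (Subsingleton.elim _ _)⟩
    exact hν.ne_zero (Measure.eq_zero_of_isEmpty ν)
  exact H.tailAsymp_of_forall hC hα hVm hV0 hV hA0 hAm hAint hindep fun ω =>
    (H.mulVec hC (A ω)).tendsto_of_dependent (hL ω)
      (hG _ (mulVec_apply_nonneg (hA0 ω) fun j => (scaleVec_pos hK α j).le)) hα hK hV0 hV
      (fun j l δ M hδ hM => h.tendsto_pair hVm hV0 hK hα j l hδ hM) j₀

end

/-! ### The three functionals and the theorem -/

theorem HomLipschitz.eval {ι : Type*} [Fintype ι] (i : ι) :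
    HomLipschitz (fun y : ι → ℝ => y i) 1 where
  lip x y := by
    rw [one_mul]
    exact Finset.single_le_sum (f := fun j => |x j - y j|) (fun _ _ => abs_nonneg _)
      (Finset.mem_univ i)
  hom _ _ _ := rfl

/-- At an index where the minimum for `y` is attained, the difference of minima is at most `(x i - y
i) / u i`; exchanging `x` and `y` gives the other sign. -/
theorem HomLipschitz.inf'_div {ι : Type*} [Fintype ι] {I : Finset ι} (hI : I.Nonempty)
    {u : ι → ℝ} (hu : ∀ i ∈ I, 0 < u i) :
    HomLipschitz (fun y : ι → ℝ => I.inf' hI fun i => y i / u i) (∑ i ∈ I, (u i)⁻¹) where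
  lip := by
    have key : ∀ x y : ι → ℝ, (I.inf' hI fun i => x i / u i) - (I.inf' hI fun i => y i / u i) ≤
        (∑ i ∈ I, (u i)⁻¹) * ∑ j, |x j - y j| := by
      intro x y
      obtain ⟨i, hi, hmin⟩ := I.exists_mem_eq_inf' hI fun i => y i / u i
      rw [hmin]
      have h1 : (I.inf' hI fun i => x i / u i) ≤ x i / u i := Finset.inf'_le _ hi
      have h2 : x i / u i - y i / u i = (u i)⁻¹ * (x i - y i) := by ring
      have h3 : (u i)⁻¹ ≤ ∑ i ∈ I, (u i)⁻¹ :=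
        Finset.single_le_sum (f := fun i => (u i)⁻¹) (fun j hj => (inv_pos.2 (hu j hj)).le) hi
      have h4 : |x i - y i| ≤ ∑ j, |x j - y j| :=
        Finset.single_le_sum (f := fun j => |x j - y j|) (fun _ _ => abs_nonneg _)
          (Finset.mem_univ i)
      have h5 := inv_pos.2 (hu i hi)
      calc _ ≤ (u i)⁻¹ * (x i - y i) := by linarith
        _ ≤ (u i)⁻¹ * |x i - y i| := by gcongr; exact le_abs_self _
        _ ≤ _ := mul_le_mul h3 h4 (abs_nonneg _) (h5.le.trans h3)
    intro x y
    refine abs_sub_le_iff.2 ⟨key x y, ?_⟩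
    simpa only [abs_sub_comm] using key y x
  hom s x hs := by
    rw [Finset.apply_inf'_eq_inf'_comp hI (fun y => s * y) fun _ _ => mul_min_of_nonneg _ _ hs]
    exact Finset.inf'_congr hI rfl fun i _ => mul_div_assoc _ _ _

/-- Expanding in the canonical unit vectors, which have norm one, bounds `N` by the `ℓ¹` norm. -/
theorem HomLipschitz.seminorm {ι : Type*} [Fintype ι] [DecidableEq ι] (N : Seminorm ℝ (ι → ℝ))
    (hN1 : ∀ i, N (Pi.single i 1) = 1) : HomLipschitz N 1 where
  lip x y := by
    refine (abs_sub_map_le_sub N x y).trans ?_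
    rw [one_mul]
    have h1 : x - y = ∑ j, (x j - y j) • (Pi.single j 1 : ι → ℝ) := by
      conv_lhs => rw [pi_eq_sum_univ' (x - y)]
      refine Finset.sum_congr rfl fun j _ => ?_
      congr 1
    calc N (x - y) = N (∑ j, (x j - y j) • (Pi.single j 1 : ι → ℝ)) := by rw [← h1]
      _ ≤ ∑ j, N ((x j - y j) • (Pi.single j 1 : ι → ℝ)) :=
          Finset.le_sum_of_subadditive N (_root_.map_zero N).le (map_add_le_add N) _ _
      _ = ∑ j, |x j - y j| := by simp [map_smul_eq_mul, hN1]
  hom s x hs := by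
    rw [map_smul_eq_mul, Real.norm_of_nonneg hs]

theorem theorem3p2 {Ω : Type*} [MeasurableSpace Ω] (P : Measure Ω) [IsProbabilityMeasure P]
    {q d : ℕ} (α : ℝ) (hα : 0 < α) (K : Fin d → ℝ) (hK : ∀ j, 0 < K j)
    -- the claims: nonnegative, with Pareto tails
    (V : Ω → Fin d → ℝ) (hVm : Measurable V) (hV0 : ∀ ω j, 0 ≤ V ω j)
    (hV : ∀ j, (fun t => P.real {ω | t < V ω j}) ~[atTop] fun t => K j * t ^ (-α))
    -- the random bipartite graph, its weights, and the weighted adjacency matrix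
    (E : Fin q → Fin d → Set Ω) (hE : ∀ i j, MeasurableSet (E i j))
    (W : Fin q → Fin d → Ω → ℝ) (hWm : ∀ i j, Measurable (W i j)) (hW0 : ∀ i j ω, 0 ≤ W i j ω)
    (A : Ω → Matrix (Fin q) (Fin d) ℝ) (hA : A = weightedAdjacency E W)
    (hAint : ∀ i j, Integrable (fun ω => A ω i j ^ α) P)
    (hindep : IndepFun (fun ω (p : Fin q × Fin d) => A ω p.1 p.2) V P)
    -- a norm on `ℝ^q` under which all canonical unit vectors have norm one
    (N : Seminorm ℝ (Fin q → ℝ)) (hN0 : ∀ x, N x = 0 → x = 0)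
    (hN1 : ∀ i, N (Pi.single i 1) = 1) :
    (AsymptoticallyIndependent P V α →
      (∀ i, TailAsymp (fun t => P.real {ω | t < exposure A V ω i})
        (∑ j, K j * ∫ ω, A ω i j ^ α ∂P) α) ∧
      (∀ (I : Finset (Fin q)) (hI : I.Nonempty) (u : Fin q → ℝ), (∀ i ∈ I, 0 < u i) →
        TailAsymp (fun t => P.real {ω | ∀ i ∈ I, u i * t < exposure A V ω i})
          (∑ j, K j * ∫ ω, (I.inf' hI fun i => A ω i j / u i) ^ α ∂P) α) ∧
      TailAsymp (fun t => P.real {ω | t < N (exposure A V ω)})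
        (∑ j, K j * ∫ ω, N (A ω *ᵥ Pi.single j 1) ^ α ∂P) α) ∧
    (AsymptoticallyFullyDependent P V K α →
      (∀ i, TailAsymp (fun t => P.real {ω | t < exposure A V ω i})
        (∫ ω, (A ω *ᵥ scaleVec K α) i ^ α ∂P) α) ∧
      (∀ (I : Finset (Fin q)) (hI : I.Nonempty) (u : Fin q → ℝ), (∀ i ∈ I, 0 < u i) →
        TailAsymp (fun t => P.real {ω | ∀ i ∈ I, u i * t < exposure A V ω i})
          (∫ ω, (I.inf' hI fun i => (A ω *ᵥ scaleVec K α) i / u i) ^ α ∂P) α) ∧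
      TailAsymp (fun t => P.real {ω | t < N (exposure A V ω)})
        (∫ ω, N (A ω *ᵥ scaleVec K α) ^ α ∂P) α) := by

  have hT := fun j => tendsto_rpow_mul_of_isEquivalent (hV j)
  have hA0 : ∀ ω i j, 0 ≤ A ω i j := by
    intro ω i j
    rw [hA]
    exact Set.indicator_nonneg (fun ω _ => hW0 i j ω) ω
  have hAm : ∀ i j, Measurable fun ω => A ω i j := by
    intro i j
    rw [hA]
    exact (hWm i j).indicator (hE i j)
  -- A joint exceedance is an exceedance of the minimum functional.
  have hmin : ∀ (I : Finset (Fin q)) (hI : I.Nonempty) (u : Fin q → ℝ), (∀ i ∈ I, 0 < u i) →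
      (fun t => P.real {ω | ∀ i ∈ I, u i * t < exposure A V ω i}) =
        fun t => P.real {ω | t < I.inf' hI fun i => exposure A V ω i / u i} := by
    intro I hI u hu
    funext t
    congr 1
    ext ω
    show (∀ i ∈ I, u i * t < exposure A V ω i) ↔ t < I.inf' hI fun i => exposure A V ω i / u i
    rw [Finset.lt_inf'_iff]
    refine forall₂_congr fun i hi => ?_
    rw [lt_div_iff₀ (hu i hi), mul_comm]
  have hinf : ∀ (I : Finset (Fin q)) (hI : I.Nonempty) (u : Fin q → ℝ), (∀ i ∈ I, 0 < u i) →
      ∀ y : Fin q → ℝ, (∀ i, 0 ≤ y i) → 0 ≤ I.inf' hI fun i => y i / u i :=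
    fun I hI u hu y hy => Finset.le_inf' _ _ fun i hi => div_nonneg (hy i) (hu i hi).le
  have hsum : ∀ (I : Finset (Fin q)) (u : Fin q → ℝ), (∀ i ∈ I, 0 < u i) →
      0 ≤ ∑ i ∈ I, (u i)⁻¹ :=
    fun I u hu => Finset.sum_nonneg fun i hi => (inv_pos.2 (hu i hi)).le
  refine ⟨fun h => ⟨fun i => ?_, fun I hI u hu => ?_, ?_⟩,
    fun h => ⟨fun i => ?_, fun I hI u hu => ?_, ?_⟩⟩
  · simpa using (HomLipschitz.eval i).tailAsymp_of_asymptoticallyIndependent zero_le_one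
      (fun y hy => hy i) hα hVm hV0 hT hA0 hAm hAint hindep h
  · rw [hmin I hI u hu]
    simpa using (HomLipschitz.inf'_div hI hu).tailAsymp_of_asymptoticallyIndependent (hsum I u hu)
      (hinf I hI u hu) hα hVm hV0 hT hA0 hAm hAint hindep h
  · exact (HomLipschitz.seminorm N hN1).tailAsymp_of_asymptoticallyIndependent zero_le_one
      (fun y _ => apply_nonneg N y) hα hVm hV0 hT hA0 hAm hAint hindep h
  · exact (HomLipschitz.eval i).tailAsymp_of_asymptoticallyFullyDependent zero_le_one
      (fun y hy => hy i) hα hK hVm hV0 hT hA0 hAm hAint hindep h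
  · rw [hmin I hI u hu]
    exact (HomLipschitz.inf'_div hI hu).tailAsymp_of_asymptoticallyFullyDependent (hsum I u hu)
      (hinf I hI u hu) hα hK hVm hV0 hT hA0 hAm hAint hindep h
  · exact (HomLipschitz.seminorm N hN1).tailAsymp_of_asymptoticallyFullyDependent zero_le_one
      (fun y _ => apply_nonneg N y) hα hK hVm hV0 hT hA0 hAm hAint hindep h
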